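/- **Theorem 2.1.** Products $X^k$ of a metric space $(X,d)$ carry the sum metric $d(\vec x,\vec y)=\sum_{j} d(x_j,y_j)$, and $d(\vec x,R)=\inf_{\vec y\in R}d(\vec x,\vec y)$ for $\vec x\in X^k$ and $\emptyset\neq R\subseteq X^k$ (put $d(\vec x,\emptyset)=\infty$). A *Polish metric space* is a complete separable metric space. The *Urysohn space* $\mathbb U$ is the Polish metric space, unique up to isometry, such that for every finite metric space $B$, every $A\subseteq B$ (possibly empty) and every isometric embedding $\varphi:A\to\mathbb U$ there is an isometric embedding $\psi:B\to\mathbb U$ extending $\varphi$. Let $1\le n_1\le\dots\le n_m$ be integers. A *structure* $(X,G_1,\dots,G_m)$ is a Polish metric space $X$ with closed sets $G_i\subseteq X^{n_i}$, $i\le m$. For a map $f$ write $f(\vec x)=(f(x_1),\dots,f(x_k))$. A structure $(Y,F_1,\dots,F_m)$ is * *universal* if for every structure $(X,G_1,\dots,G_m)$ there is an isometric embedding $\iota:X\to Y$ such that for all $i\le m$ and $\vec x\in X^{n_i}$ we have $\iota(\vec x)\in F_i\iff\vec x\in G_i$, and moreover $d(\iota(\vec x),F_i)=d(\vec x,G_i)$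 whenever $G_i\ne\emptyset$; * *ultrahomogeneous* if every isometric embedding $\varphi:A\to Y$ of a finite set $A\subseteq Y$ with $d(\varphi(\vec a),F_i)=d(\vec a,F_i)$ for all $i\le m$ and $\vec a\in A^{n_i}$ extends to a surjective isometry $\Phi:Y\to Y$ such that $\Phi(\vec y)\in F_i\iff\vec y\in F_i$ for all $i\le m$ and $\vec y\in Y^{n_i}$. Then the Urysohn space $\mathbb U$ exists, and there are closed relations $F_{n_i}\subseteq\mathbb U^{n_i}$, $i\le m$, such that the structure $(\mathbb U,F_{n_1},\dots,F_{n_m})$ is universal and ultrahomogeneous. It is unique: for every universal and ultrahomogeneous structure $(Y,G_1,\dots,G_m)$ there is a surjective isometry $\Phi:\mathbb U\to Y$ such that $\Phi(\vec x)\in G_i\iff\vec x\in F_{n_i}$ for all $i\le m$ and $\vec x\in\mathbb U^{n_i}$. -/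

import Mathlib

open scoped ENNReal

universe u

/-- The Urysohn space: a complete separable metric space `U` in which, over every finite subspace
(possibly empty), every abstract finite metric extension is realized. Here `B` is the abstract
finite metric space, `A ⊆ B` the part already placed isometrically in `U` by `φ`.
These properties determine `U` up to isometry. -/
structure IsUrysohnSpace (U : Type u) [MetricSpace U] : Prop where
  complete : CompleteSpace U
  separable : TopologicalSpace.SeparableSpace U
  extension : ∀ (B : Type u) [MetricSpace B] [Finite B] (A : Set B) (φ : A → U),
    Isometry φ → ∃ ψ : B → U, Isometry ψ ∧ ∀ a : A, ψ a = φ a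

/-- The distance of a tuple `x` from a set `R` of `k`-tuples, in the sum metric
`d(x, y) = ∑ j, d(x j, y j)` on `X ^ k`; it is `∞` exactly when `R` is empty. -/
noncomputable def relDist {X : Type u} [MetricSpace X] {k : ℕ} (R : Set (Fin k → X))
    (x : Fin k → X) : ℝ≥0∞ :=
  ⨅ y ∈ R, ∑ j, edist (x j) (y j)

/-- `(U, F)` is universal: every Polish metric structure `(X, G)` (a complete separable metric space
with closed relations `G i ⊆ X ^ (n i)`) embeds isometrically in `U` so that the relations are
preserved in both directions and the distances of tuples from the relations are preserved, the
latter where such a distance exists, i.e. for non-empty `G i`. -/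
def IsUniversalStructure {m : ℕ} (n : Fin m → ℕ) {U : Type u} [MetricSpace U]
    (F : ∀ i, Set (Fin (n i) → U)) : Prop :=
  ∀ (X : Type u) [MetricSpace X] [CompleteSpace X] [TopologicalSpace.SeparableSpace X]
    (G : ∀ i, Set (Fin (n i) → X)), (∀ i, IsClosed (G i)) →
    ∃ ι : X → U, Isometry ι ∧
      (∀ i, ∀ x : Fin (n i) → X, (fun j => ι (x j)) ∈ F i ↔ x ∈ G i) ∧
      (∀ i, (G i).Nonempty → ∀ x : Fin (n i) → X,
        relDist (F i) (fun j => ι (x j)) = relDist (G i) x)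

/-- `(U, F)` is ultrahomogeneous: every isomorphism between finite substructures (an isometric map
`φ` on a finite `A ⊆ U` that preserves the distances of tuples from each of the relations) extends
to an automorphism of `(U, F)` (a surjective isometry that preserves the relations). -/
def IsUltrahomogeneousStructure {m : ℕ} (n : Fin m → ℕ) {U : Type u} [MetricSpace U]
    (F : ∀ i, Set (Fin (n i) → U)) : Prop :=
  ∀ (A : Set U), A.Finite → ∀ φ : A → U, Isometry φ →
    (∀ i, ∀ x : Fin (n i) → A,
      relDist (F i) (fun j => φ (x j)) = relDist (F i) (fun j => (x j : U))) →
    ∃ Φ : U ≃ᵢ U, (∀ i, ∀ x : Fin (n i) → U, (fun j => Φ (x j)) ∈ F i ↔ x ∈ F i) ∧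
      ∀ a : A, Φ a = φ a

/-! A closed relation is recovered as the zero set of its distance function, which is non-negative
and `1`-Lipschitz for the sum metric. So relations are replaced by arbitrary families of such
functions (`IsLip`); an empty relation is encoded by the constant `1`. The gain is free
amalgamation: two structures joined along finitely many pairs carry a path metric on their disjoint
union, and the functions extend to mixed tuples by McShane's formula (`exists_amalgam`).

All structures on a fixed countably infinite set form a Polish space. By Baire category a generic
one approximates every one-point extension (`exists_hasApproxPoints`); amalgamation turns this into
exact realization in the completion (`HasApproxPoints.exists_exact`). The result is a complete
separable structure in which every finite partial embedding extends by one point (`HasExtension`).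
Back-and-forth then shows that separable structures embed in it and that finite partial isomorphisms
between two such structures extend to isomorphisms.

To return to relations: in such a structure each function is the distance from its own zero set,
because a nearby tuple of value zero can be adjoined abstractly and is then realized
(`HasExtension.exists_zero`). This gives universality and ultrahomogeneity. Conversely, a universal
and ultrahomogeneous structure has the extension property
(`HasExtension.of_universal_of_ultrahomogeneous`): universality supplies a copy of the required
finite configuration, and ultrahomogeneity moves it into place. Uniqueness is again back-and-forth.
The Urysohn space is the case without functions, so any Urysohn space is isometric to the space
constructed here and inherits its functions. -/

/-! ### Lipschitz functions on powers. -/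

/-- A family of non-negative functions on powers of `X`, each `1`-Lipschitz for the sum metric. -/
def IsLip {m : ℕ} {n : Fin m → ℕ} {X : Type*} [PseudoMetricSpace X]
    (f : ∀ i, (Fin (n i) → X) → ℝ) : Prop :=
  ∀ i, (∀ x, 0 ≤ f i x) ∧ ∀ x y, f i x ≤ f i y + ∑ j, dist (x j) (y j)

/-- McShane extension of a partial `1`-Lipschitz function on a power with the sum metric. -/
theorem exists_lipschitz_extension {Y J : Type*} [PseudoMetricSpace Y] {k : ℕ}
    (e : J → Fin k → Y) (h : J → ℝ) (h0 : ∀ a, 0 ≤ h a)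
    (hl : ∀ a b, h a ≤ h b + ∑ j, dist (e a j) (e b j)) :
    ∃ F : (Fin k → Y) → ℝ, (∀ x, 0 ≤ F x) ∧ (∀ x y, F x ≤ F y + ∑ j, dist (x j) (y j)) ∧
      ∀ a, F (e a) = h a := by
  have hpos : ∀ (x : Fin k → Y) a, 0 ≤ h a + ∑ j, dist (x j) (e a j) := fun x a =>
    add_nonneg (h0 a) (Finset.sum_nonneg fun _ _ => dist_nonneg)
  have hb : ∀ x : Fin k → Y, BddBelow (Set.range fun a => h a + ∑ j, dist (x j) (e a j)) :=
      fun x =>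
    ⟨0, by rintro _ ⟨a, rfl⟩; exact hpos x a⟩
  refine ⟨fun (x : Fin k → Y) => ⨅ a, h a + ∑ j, dist (x j) (e a j), 
    fun x => Real.iInf_nonneg (hpos x),
    fun x y => ?_, fun a => le_antisymm ?_ ?_⟩
  · rcases isEmpty_or_nonempty J with hJ | hJ
    -- A real infimum over the empty index type is `0`, so here the extension is the zero function.
    · simpa [Real.iInf_of_isEmpty] using Finset.sum_nonneg fun _ _ => dist_nonneg
    · rw [← sub_le_iff_le_add]
      refine le_ciInf fun a => ?_
      rw [sub_le_iff_le_add]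
      refine (ciInf_le (hb x) a).trans ?_
      rw [add_assoc, ← Finset.sum_add_distrib]
      gcongr with j
      rw [add_comm]
      exact dist_triangle _ _ _
  · exact (ciInf_le (hb _) a).trans (by simp)
  · have : Nonempty J := ⟨a⟩
    exact le_ciInf fun b => hl a b

/-! ### Gluing of spaces and amalgamation of structures. -/

section Glue

variable {X B I : Type*} [PseudoMetricSpace X] [PseudoMetricSpace B]
  (α : I → X) (β : I → B) (w : I → ℝ)

/-- The distance between a point of `X` and a point of `B`, when `α i` and `β i` are joined by a
path of length `w i`. -/
noncomputable def crossDist (x : X) (b : B) : ℝ := ⨅ i, dist x (α i) + w i + dist (β i) b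

/-- The distance on the disjoint union of two spaces joined by paths. -/
noncomputable def glueDistance : X ⊕ B → X ⊕ B → ℝ
  | .inl x, .inl y => dist x y
  | .inr a, .inr b => dist a b
  | .inl x, .inr b => crossDist α β w x b
  | .inr b, .inl x => crossDist α β w x b

variable {α β w}

theorem crossDist_le [Finite I] (x : X) (b : B) (i : I) :
    crossDist α β w x b ≤ dist x (α i) + w i + dist (β i) b :=
  ciInf_le (Set.finite_range _).bddBelow i

theorem exists_crossDist_eq [Finite I] [Nonempty I] (x : X) (b : B) :
    ∃ i, crossDist α β w x b = dist x (α i) + w i + dist (β i) b := by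
  obtain ⟨i, hi⟩ := exists_eq_ciInf_of_finite (f := fun i => dist x (α i) + w i + dist (β i) b)
  exact ⟨i, hi.symm⟩

/-- The disjoint union of two spaces joined by paths that do not create shortcuts. -/
noncomputable abbrev gluePseudoMetric [Finite I] [Nonempty I]
    (hd : ∀ i j, |dist (α i) (α j) - dist (β i) (β j)| ≤ w i + w j) :
    PseudoMetricSpace (X ⊕ B) where
  dist := glueDistance α β w
  dist_self p := by cases p <;> simp [glueDistance]
  dist_comm p q := by cases p <;> cases q <;> simp [glueDistance, dist_comm]
  dist_triangle p q r := by
    rcases p with p | p <;> rcases q with q | q <;> rcases r with r | r <;>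
      simp only [glueDistance]
    · exact dist_triangle _ _ _
    · obtain ⟨i, hi⟩ := exists_crossDist_eq (α := α) (β := β) (w := w) q r
      have := crossDist_le (α := α) (β := β) (w := w) p r i
      linarith [dist_triangle p q (α i)]
    -- A path that crosses over and returns, possibly by a different bridge; `hd` says that this is
    -- no shortcut. Its mirror image is the only other case that needs `hd`.
    · obtain ⟨i, hi⟩ := exists_crossDist_eq (α := α) (β := β) (w := w) p q
      obtain ⟨j, hj⟩ := exists_crossDist_eq (α := α) (β := β) (w := w) r q
      have := abs_le.1 (hd i j)
      linarith [dist_triangle4 p (α i) (α j) r, dist_triangle_right (β i) (β j) q,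
        dist_comm (α j) r]
    · obtain ⟨i, hi⟩ := exists_crossDist_eq (α := α) (β := β) (w := w) p q
      have := crossDist_le (α := α) (β := β) (w := w) p r i
      linarith [dist_triangle (β i) q r]
    · obtain ⟨i, hi⟩ := exists_crossDist_eq (α := α) (β := β) (w := w) q p
      have := crossDist_le (α := α) (β := β) (w := w) r p i
      linarith [dist_triangle r q (α i), dist_comm r q]
    · obtain ⟨i, hi⟩ := exists_crossDist_eq (α := α) (β := β) (w := w) q p
      obtain ⟨j, hj⟩ := exists_crossDist_eq (α := α) (β := β) (w := w) q r
      have := abs_le.1 (hd i j)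
      linarith [dist_triangle4 p (β i) (β j) r, dist_triangle_left (α i) (α j) q,
        dist_comm p (β i)]
    · obtain ⟨i, hi⟩ := exists_crossDist_eq (α := α) (β := β) (w := w) r q
      have := crossDist_le (α := α) (β := β) (w := w) r p i
      linarith [dist_triangle (β i) q p, dist_comm p q]
    · exact dist_triangle _ _ _

end Glue

/-- Amalgamation of two structures along finitely many pairs of points `α i`, `β i`, which are
placed at distance at most `w i`. -/
theorem exists_amalgam {m : ℕ} {n : Fin m → ℕ} {X B : Type u} {I : Type*} [PseudoMetricSpace X]
    [PseudoMetricSpace B] [Finite I] [Nonempty I]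
    {f : ∀ i, (Fin (n i) → X) → ℝ} {g : ∀ i, (Fin (n i) → B) → ℝ} (hf : IsLip f) (hg : IsLip g)
    (α : I → X) (β : I → B) (w : I → ℝ)
    (hd : ∀ i j, |dist (α i) (α j) - dist (β i) (β j)| ≤ w i + w j)
    (hfg : ∀ i (s : Fin (n i) → I),
      |f i (fun j => α (s j)) - g i (fun j => β (s j))| ≤ ∑ j, w (s j)) :
    ∃ (C : Type u) (_ : PseudoMetricSpace C) (h : ∀ i, (Fin (n i) → C) → ℝ) (a : X → C)
      (b : B → C), IsLip h ∧ (∀ x y, dist (a x) (a y) = dist x y) ∧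
      (∀ x y, dist (b x) (b y) = dist x y) ∧ (∀ i x, h i (fun j => a (x j)) = f i x) ∧
      (∀ i x, h i (fun j => b (x j)) = g i x) ∧ ∀ i, dist (a (α i)) (b (β i)) ≤ w i := by
  let _ := gluePseudoMetric hd
  have hc : ∀ x y, dist (Sum.inl x : X ⊕ B) (Sum.inr y) = crossDist α β w x y := fun _ _ => rfl
  have hXX : ∀ x y, dist (Sum.inl x : X ⊕ B) (Sum.inl y) = dist x y := fun _ _ => rfl
  have hBB : ∀ x y, dist (Sum.inr x : X ⊕ B) (Sum.inr y) = dist x y := fun _ _ => rfl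
  -- The Lipschitz condition between a tuple of `X` and a tuple of `B`: route each coordinate
  -- through the bridge that attains its cross distance. Then `f` and `g` together are `1`-Lipschitz
  -- on the unmixed tuples and extend to the mixed ones.
  have key : ∀ i (x : Fin (n i) → X) (b : Fin (n i) → B),
      |f i x - g i b| ≤ ∑ j, crossDist α β w (x j) (b j) := by
    intro i x b
    choose s hs using fun j => exists_crossDist_eq (α := α) (β := β) (w := w) (x j) (b j)
    have h1 := (hf i).2 x (fun j => α (s j))
    have h2 := (hf i).2 (fun j => α (s j)) x
    have h3 := (hg i).2 b (fun j => β (s j))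
    have h4 := (hg i).2 (fun j => β (s j)) b
    have h5 := abs_le.1 (hfg i s)
    simp only [hs, Finset.sum_add_distrib]
    simp only [dist_comm (b _), dist_comm (α _)] at h1 h2 h3 h4
    rw [abs_le]
    constructor <;> linarith
  have ext : ∀ i, ∃ F : (Fin (n i) → X ⊕ B) → ℝ, (∀ x, 0 ≤ F x) ∧
      (∀ x y, F x ≤ F y + ∑ j, dist (x j) (y j)) ∧
      ∀ p : (Fin (n i) → X) ⊕ (Fin (n i) → B),
        F (Sum.elim (fun x j => Sum.inl (x j)) (fun b j => Sum.inr (b j)) p) =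
          Sum.elim (f i) (g i) p := by
    intro i
    refine exists_lipschitz_extension _ _ ?_ ?_
    · rintro (x | b)
      · exact (hf i).1 x
      · exact (hg i).1 b
    · rintro (x | b) (y | c) <;> simp only [Sum.elim_inl, Sum.elim_inr]
      · exact (hf i).2 x y
      · have := abs_le.1 (key i x c)
        simp only [hc]
        linarith
      · have := abs_le.1 (key i y b)
        simp only [dist_comm (Sum.inr _ : X ⊕ B) (Sum.inl _), hc]
        linarith
      · exact (hg i).2 b c
  choose h h0 hl hh using ext
  refine ⟨X ⊕ B, inferInstance, h, Sum.inl, Sum.inr, fun i => ⟨h0 i, hl i⟩, hXX, hBB,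
    fun i x => hh i (.inl x), fun i x => hh i (.inr x), fun i => ?_⟩
  rw [hc]
  exact (crossDist_le _ _ i).trans (by simp)

/-! ### Exact and approximate embeddings. -/

/-- `e` is an embedding of the structure `(X, f)` in the structure `(C, h)`. -/
def IsStrEmbedding {m : ℕ} {n : Fin m → ℕ} {X C : Type*} [PseudoMetricSpace X]
    [PseudoMetricSpace C] (f : ∀ i, (Fin (n i) → X) → ℝ) (h : ∀ i, (Fin (n i) → C) → ℝ)
    (e : X → C) : Prop :=
  (∀ x y, dist (e x) (e y) = dist x y) ∧ ∀ i x, h i (fun j => e (x j)) = f i x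

/-- The pairs in `R` match distances and values of `f` and `g` with error at most `ε`. -/
def IsApproxIso {m : ℕ} {n : Fin m → ℕ} {X B : Type*} [PseudoMetricSpace X]
    [PseudoMetricSpace B] (f : ∀ i, (Fin (n i) → X) → ℝ) (g : ∀ i, (Fin (n i) → B) → ℝ)
    (ε : ℝ) (R : Set (X × B)) : Prop :=
  (∀ a ∈ R, ∀ b ∈ R, |dist a.1 b.1 - dist a.2 b.2| ≤ ε) ∧
  ∀ i (s : Fin (n i) → X × B), (∀ j, s j ∈ R) →
    |f i (fun j => (s j).1) - g i (fun j => (s j).2)| ≤ ε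

/-- Every point `c` of a structure containing `(X, f)` is approximated over every finite subset
of `X` by a point of `X`. -/
def HasApproxPoints {m : ℕ} {n : Fin m → ℕ} {X : Type u} [PseudoMetricSpace X]
    (f : ∀ i, (Fin (n i) → X) → ℝ) : Prop :=
  ∀ (C : Type u) [PseudoMetricSpace C] (h : ∀ i, (Fin (n i) → C) → ℝ) (e : X → C), IsLip h →
    IsStrEmbedding f h e → ∀ (c : C) (T : Set X), T.Finite → ∀ ε > 0,
      ∃ z, IsApproxIso f h ε (insert (z, c) ((fun t => (t, e t)) '' T))

/-! ### Generic structures by Baire category. -/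

section Generic

variable {m : ℕ} (n : Fin m → ℕ) (S : Type u)

/-- The structures with underlying set `S`, as pairs of a pseudometric and a family of
functions. -/
def structureSet : Set ((S → S → ℝ) × (∀ i, (Fin (n i) → S) → ℝ)) :=
  {ω | (∀ s, ω.1 s s = 0) ∧ (∀ s t, ω.1 s t = ω.1 t s) ∧
    (∀ s t r, ω.1 s r ≤ ω.1 s t + ω.1 t r) ∧ (∀ i x, 0 ≤ ω.2 i x) ∧
    ∀ i x y, ω.2 i x ≤ ω.2 i y + ∑ j, ω.1 (x j) (y j)}

theorem isClosed_structureSet : IsClosed (structureSet n S) := by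
  simp only [structureSet, Set.ofPred_and, Set.ofPred_forall]
  refine .inter ?_ (.inter ?_ (.inter ?_ (.inter ?_ ?_)))
  · exact isClosed_iInter fun s => isClosed_eq (by fun_prop) (by fun_prop)
  · exact isClosed_iInter fun s => isClosed_iInter fun t =>
      isClosed_eq (by fun_prop) (by fun_prop)
  · exact isClosed_iInter fun s => isClosed_iInter fun t => isClosed_iInter fun r =>
      isClosed_le (by fun_prop) (by fun_prop)
  · exact isClosed_iInter fun i => isClosed_iInter fun x =>
      isClosed_le (by fun_prop) (by fun_prop)
  · exact isClosed_iInter fun i => isClosed_iInter fun x => isClosed_iInter fun y =>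
      isClosed_le (by fun_prop) (by fun_prop)

variable {n S}

/-- The pseudometric of a point of `structureSet`. -/
abbrev structurePseudoMetric (ω : structureSet n S) : PseudoMetricSpace S where
  dist := ω.1.1
  dist_self := ω.2.1
  dist_comm := ω.2.2.1
  dist_triangle := ω.2.2.2.1

/-- The structures in which some point realizes the values `v` over `T` with error less than
`ε`. -/
def realizing (T : Finset S) (v : (T → ℚ) × (∀ i, (Fin (n i) → Option T) → ℚ)) (ε : ℝ) :
    Set (structureSet n S) :=
  {ω | ∃ z : S, (∀ t : T, |ω.1.1 t z - v.1 t| < ε) ∧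
    ∀ i (s : Fin (n i) → Option T), |ω.1.2 i (fun j => (s j).elim z (↑)) - v.2 i s| < ε}

theorem isOpen_realizing (T : Finset S) (v : (T → ℚ) × (∀ i, (Fin (n i) → Option T) → ℚ))
    (ε : ℝ) : IsOpen (realizing T v ε) := by
  simp only [realizing, Set.ofPred_exists, Set.ofPred_and, Set.ofPred_forall]
  refine isOpen_iUnion fun z => .inter ?_ ?_
  · exact isOpen_iInter_of_finite fun t => isOpen_lt (by fun_prop) (by fun_prop)
  · exact isOpen_iInter_of_finite fun i => isOpen_iInter_of_finite fun s =>
      isOpen_lt (by fun_prop) (by fun_prop)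

/-- Pull the structure of `C` back along the map that is `e` on a finite set `N` and constantly `c`
off `N`. As `N` grows, each coordinate is eventually that of `ω`, while any point outside `N` plays
the role of `c`. The pullback identifies points, which is why pseudometrics are used. -/
theorem mem_closure_realizing [Infinite S] (ω : structureSet n S) {C : Type*}
    [PseudoMetricSpace C] {h : ∀ i, (Fin (n i) → C) → ℝ} (hh : IsLip h) {e : S → C}
    (hd : ∀ s t, dist (e s) (e t) = ω.1.1 s t) (hf : ∀ i x, h i (fun j => e (x j)) = ω.1.2 i x)
    (c : C) (T : Finset S) (v : (T → ℚ) × (∀ i, (Fin (n i) → Option T) → ℚ)) (ε : ℝ)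
    (hv1 : ∀ t : T, |dist (e t) c - v.1 t| < ε)
    (hv2 : ∀ i (s : Fin (n i) → Option T),
      |h i (fun j => (s j).elim c (fun t => e t)) - v.2 i s| < ε) :
    ω ∈ closure (realizing T v ε) := by
  classical
  let p : Finset S → S → C := fun N s => if s ∈ N then e s else c
  have hp : ∀ s, ∀ᶠ N in Filter.atTop, p N s = e s := fun s => by
    filter_upwards [Filter.eventually_ge_atTop {s}] with N hN
    exact if_pos (hN (Finset.mem_singleton_self s))
  let Ω : Finset S → structureSet n S := fun N =>
    ⟨(fun s t => dist (p N s) (p N t), fun i x => h i (fun j => p N (x j))),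
      fun _ => dist_self _, fun _ _ => dist_comm _ _, fun _ _ _ => dist_triangle _ _ _,
      fun i _ => (hh i).1 _, fun i _ _ => (hh i).2 _ _⟩
  refine mem_closure_of_tendsto (f := Ω) (b := Filter.atTop) ?_ ?_
  · rw [tendsto_subtype_rng, Prod.tendsto_iff]
    constructor
    · refine tendsto_pi_nhds.2 fun s => tendsto_pi_nhds.2 fun t => ?_
      refine tendsto_const_nhds.congr' ?_
      filter_upwards [hp s, hp t] with N h1 h2
      simp only [Ω, h1, h2, hd]
    · refine tendsto_pi_nhds.2 fun i => tendsto_pi_nhds.2 fun x => ?_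
      refine tendsto_const_nhds.congr' ?_
      filter_upwards [Filter.eventually_all.2 fun j => hp (x j)] with N h1
      simp only [Ω, h1, hf]
  · filter_upwards [Filter.eventually_ge_atTop T] with N hN
    obtain ⟨z, hz⟩ := Infinite.exists_notMem_finset N
    have hz' : p N z = c := if_neg hz
    have hT : ∀ t : T, p N t = e t := fun t => if_pos (hN t.2)
    refine ⟨z, fun t => ?_, fun i s => ?_⟩
    · simpa only [Ω, hz', hT] using hv1 t
    · have : ∀ j, p N ((s j).elim z (↑)) = (s j).elim c (fun t => e t) := fun j => by
        cases s j with
        | none => exact hz'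
        | some t => exact hT t
      simpa only [Ω, this] using hv2 i s

/-- A generic structure on a countably infinite set approximates all one-point extensions. -/
theorem exists_hasApproxPoints (n : Fin m → ℕ) (S : Type u) [Countable S] [Infinite S] :
    ∃ (_ : PseudoMetricSpace S) (f : ∀ i, (Fin (n i) → S) → ℝ), IsLip f ∧ HasApproxPoints f := by
  classical
  have := (isClosed_structureSet n S).polishSpace
  have : Nonempty (structureSet n S) :=
    ⟨⟨(fun _ _ => 0, fun _ _ => 0), by simp [structureSet]⟩⟩
  let A : (Σ T : Finset S, ((T → ℚ) × (∀ i, (Fin (n i) → Option T) → ℚ)) × ℕ) →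
    Set (structureSet n S) := fun q => realizing q.1 q.2.1 (1 / (q.2.2 + 1))
  have hA : ∀ q, IsOpen (A q) := fun q => isOpen_realizing _ _ _
  -- For open `A`, the union of `A` and the complement of its closure is open and dense. A point `ω`
  -- of all these countably many sets lies in `A q` as soon as it lies in the closure of `A q`.
  obtain ⟨ω, hω⟩ := (dense_iInter_of_isOpen (f := fun q => A q ∪ (closure (A q))ᶜ)
    (fun q => (hA q).union isClosed_closure.isOpen_compl) (fun q => by
      rw [dense_iff_closure_eq, closure_union, ← Set.univ_subset_iff,
        ← Set.union_compl_self (closure (A q))]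
      exact Set.union_subset_union_right _ subset_closure)).nonempty
  rw [Set.mem_iInter] at hω
  let _ := structurePseudoMetric ω
  refine ⟨structurePseudoMetric ω, ω.1.2, fun i => ⟨ω.2.2.2.2.1 i, ω.2.2.2.2.2 i⟩, ?_⟩
  intro C _ h e hh he c T hT ε hε
  lift T to Finset S using hT
  obtain ⟨k, hk⟩ := exists_nat_one_div_lt (half_pos hε)
  have hk0 : (0 : ℝ) < 1 / (k + 1) := by positivity
  have hq : ∀ r : ℝ, ∃ q : ℚ, |r - q| < 1 / (k + 1) := fun r => by
    obtain ⟨q, hq⟩ := exists_rat_btwn (lt_add_of_pos_right r hk0)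
    exact ⟨q, by rw [abs_lt]; constructor <;> linarith⟩
  choose q hq using hq
  have hmem := mem_closure_realizing ω hh he.1 he.2 c T
    (fun t => q (dist (e t) c), fun i s => q (h i (fun j => (s j).elim c (fun t => e t))))
    (1 / (k + 1)) (fun t => hq _) (fun i s => hq _)
  obtain ⟨z, hz1, hz2⟩ := (hω ⟨T, (_, _), k⟩).resolve_right (fun hn => hn hmem)
  have hd : ∀ t ∈ T, |dist t z - dist (e t) c| ≤ ε := fun t ht => by
    have h1 := abs_lt.1 (hz1 ⟨t, ht⟩)
    have h2 := abs_lt.1 (hq (dist (e t) c))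
    change _ < dist t z - _ ∧ dist t z - _ < _ at h1
    simp only at h1
    rw [abs_le]
    constructor <;> linarith
  refine ⟨z, ?_, fun i s hs => ?_⟩
  · rintro a (rfl | ⟨t, ht, rfl⟩) b (rfl | ⟨t', ht', rfl⟩)
    · simpa using hε.le
    · simpa only [dist_comm] using hd t' ht'
    · exact hd t ht
    · simpa [he.1] using hε.le
  · have : ∀ j, ∃ o : Option T, (s j).1 = o.elim z (↑) ∧ (s j).2 = o.elim c (fun t => e t) := by
      intro j
      rcases hs j with h | ⟨t, ht, h⟩
      · exact ⟨none, by simp [h]⟩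
      · exact ⟨some ⟨t, ht⟩, by simp [← h]⟩
    choose o ho1 ho2 using this
    have h1 := abs_lt.1 (hz2 i o)
    have h2 := abs_lt.1 (hq (h i (fun j => (o j).elim c (fun t => e t))))
    simp only [ho1, ho2]
    rw [abs_le]
    constructor <;> linarith

end Generic

/-! ### From approximate to exact realization. -/

section Approx

variable {m : ℕ} {n : Fin m → ℕ}

theorem IsLip.abs_sub_le {X : Type*} [PseudoMetricSpace X] {f : ∀ i, (Fin (n i) → X) → ℝ}
    (hf : IsLip f) (i : Fin m) (x y : Fin (n i) → X) :
    |f i x - f i y| ≤ ∑ j, dist (x j) (y j) := by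
  have h1 := (hf i).2 x y
  have h2 := (hf i).2 y x
  simp only [dist_comm (y _)] at h2
  rw [abs_le]
  constructor <;> linarith

theorem IsStrEmbedding.id {X : Type*} [PseudoMetricSpace X] (f : ∀ i, (Fin (n i) → X) → ℝ) :
    IsStrEmbedding f f id :=
  ⟨fun _ _ => rfl, fun _ _ => rfl⟩

/-- A distance has two endpoints on each side, which costs `4 * η`; a value of the `i`th function
costs `n i * η` on each side. The constant dominates both. -/
theorem IsApproxIso.perturb {S X B D : Type*} [PseudoMetricSpace S] [PseudoMetricSpace X]
    [PseudoMetricSpace B] [PseudoMetricSpace D] {f : ∀ i, (Fin (n i) → S) → ℝ}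
    {F : ∀ i, (Fin (n i) → X) → ℝ} {g : ∀ i, (Fin (n i) → B) → ℝ}
    {h : ∀ i, (Fin (n i) → D) → ℝ} (hF : IsLip F) (hh : IsLip h) {ι : S → X} {κ : B → D}
    (hι : IsStrEmbedding f F ι) (hκ : IsStrEmbedding g h κ) {δ η : ℝ} (hη : 0 ≤ η)
    {R' : Set (S × D)} (hR' : IsApproxIso f h δ R') {R : Set (X × B)}
    (hR : ∀ a ∈ R, ∃ a' ∈ R', dist a.1 (ι a'.1) ≤ η ∧ dist (κ a.2) a'.2 ≤ η) :
    IsApproxIso F g (δ + (4 + 2 * ∑ i, (n i : ℝ)) * η) R := by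
  have hK : ∀ i, (n i : ℝ) * η ≤ (∑ i, (n i : ℝ)) * η := fun i =>
    mul_le_mul_of_nonneg_right
      (Finset.single_le_sum (f := fun i => (n i : ℝ)) (fun _ _ => Nat.cast_nonneg _)
        (Finset.mem_univ i)) hη
  have hK0 : 0 ≤ (∑ i, (n i : ℝ)) * η :=
    mul_nonneg (Finset.sum_nonneg fun _ _ => Nat.cast_nonneg _) hη
  constructor
  · intro a ha b hb
    obtain ⟨a', ha', ha1, ha2⟩ := hR a ha
    obtain ⟨b', hb', hb1, hb2⟩ := hR b hb
    have h0 := abs_le.1 (hR'.1 a' ha' b' hb')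
    have h1 := abs_le.1 (dist_dist_dist_le a.1 b.1 (ι a'.1) (ι b'.1))
    have h2 := abs_le.1 (dist_dist_dist_le (κ a.2) (κ b.2) a'.2 b'.2)
    rw [hι.1] at h1
    rw [hκ.1] at h2
    rw [abs_le]
    constructor <;> linarith
  · intro i s hs
    choose s' hs' h1 h2 using fun j => hR (s j) (hs j)
    have h0 := abs_le.1 (hR'.2 i s' hs')
    have h3 := abs_le.1 (hF.abs_sub_le i (fun j => (s j).1) (fun j => ι (s' j).1))
    have h4 := abs_le.1 (hh.abs_sub_le i (fun j => κ (s j).2) (fun j => (s' j).2))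
    have h5 : ∑ j, dist (s j).1 (ι (s' j).1) ≤ n i * η := by
      simpa using Finset.sum_le_card_nsmul Finset.univ _ η (fun j _ => h1 j)
    have h6 : ∑ j, dist (κ (s j).2) (s' j).2 ≤ n i * η := by
      simpa using Finset.sum_le_card_nsmul Finset.univ _ η (fun j _ => h2 j)
    rw [hι.2 i (fun j => (s' j).1)] at h3
    rw [hκ.2 i (fun j => (s j).2)] at h4
    have := hK i
    rw [abs_le]
    constructor <;> linarith

theorem IsApproxIso.of_tendsto {X B : Type*} [PseudoMetricSpace X] [PseudoMetricSpace B]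
    {f : ∀ i, (Fin (n i) → X) → ℝ} {g : ∀ i, (Fin (n i) → B) → ℝ} {ε : ℕ → ℝ}
    (hε : Filter.Tendsto ε Filter.atTop (nhds 0)) {R : Set (X × B)}
    (hR : ∀ k, IsApproxIso f g (ε k) R) : IsApproxIso f g 0 R :=
  ⟨fun a ha b hb => ge_of_tendsto' hε fun k => (hR k).1 a ha b hb,
    fun i s hs => ge_of_tendsto' hε fun k => (hR k).2 i s hs⟩

/-- Replace the points of `T` by nearby points of the dense structure and apply `perturb`. -/
theorem HasApproxPoints.of_denseRange {S X : Type u} [PseudoMetricSpace S] [PseudoMetricSpace X]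
    {f : ∀ i, (Fin (n i) → S) → ℝ} {F : ∀ i, (Fin (n i) → X) → ℝ} (hf : HasApproxPoints f)
    (hF : IsLip F) {ι : S → X} (hι : IsStrEmbedding f F ι) (hd : DenseRange ι) :
    HasApproxPoints F := by
  intro C _ h e hh he c T hT ε hε
  have hK : 0 ≤ ∑ i, (n i : ℝ) := Finset.sum_nonneg fun _ _ => Nat.cast_nonneg _
  set K := ∑ i, (n i : ℝ)
  -- With accuracy and displacement both equal to this `η`, the total error `η + (4 + 2 * K) * η` is
  -- `ε`.
  have hη : 0 < ε / (5 + 2 * K) := by positivity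
  choose σ hσ using fun t => hd.exists_dist_lt t hη
  obtain ⟨z, hz⟩ := hf C h (fun s => e (ι s)) hh
    ⟨fun x y => (he.1 _ _).trans (hι.1 _ _), fun i x => (he.2 i _).trans (hι.2 i x)⟩ c
    (σ '' T) (hT.image σ) _ hη
  refine ⟨ι z, ?_⟩
  have := hz.perturb hF hh hι (IsStrEmbedding.id h) hη.le
    (R := insert (ι z, c) ((fun t => (t, e t)) '' T)) ?_
  · convert this using 1
    field_simp
    ring
  · rintro _ (rfl | ⟨t, ht, rfl⟩)
    · exact ⟨(z, c), .inl rfl, by simpa using hη.le, by simpa using hη.le⟩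
    · refine ⟨(σ t, e (ι (σ t))), .inr ⟨σ t, ⟨t, ht, rfl⟩, rfl⟩, (hσ t).le, ?_⟩
      simpa only [_root_.id, he.1] using (hσ t).le

/-- Improved approximations can be chosen near the old one. Since `z` has the type of `c` up to `δ`,
one can amalgamate so that `T` is identified with its image and `c` lies within `δ` of `z`.
Approximating `c` over `insert z T` then also controls the distance from `z`. -/
theorem HasApproxPoints.exists_closer {X C : Type u} [PseudoMetricSpace X] [PseudoMetricSpace C]
    {F : ∀ i, (Fin (n i) → X) → ℝ} (hQ : HasApproxPoints F) (hF : IsLip F)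
    {h : ∀ i, (Fin (n i) → C) → ℝ} (hh : IsLip h) {e : X → C} (he : IsStrEmbedding F h e)
    {c : C} {T : Set X} (hT : T.Finite) {δ : ℝ} (hδ : 0 ≤ δ) {z : X}
    (hz : IsApproxIso F h δ (insert (z, c) ((fun t => (t, e t)) '' T))) {δ' : ℝ} (hδ' : 0 < δ') :
    ∃ z', IsApproxIso F h δ' (insert (z', c) ((fun t => (t, e t)) '' T)) ∧
      dist z z' ≤ δ + δ' := by
  have := hT.to_subtype
  have hw : ∀ o : Option T, 0 ≤ o.elim δ (fun _ => 0) := by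
    rintro (_ | _)
    · exact hδ
    · exact le_rfl
  have hmem : ∀ o : Option T, (o.elim z (↑), o.elim c (fun t => e t)) ∈
      insert (z, c) ((fun t => (t, e t)) '' T) := by
    rintro (_ | t)
    · exact .inl rfl
    · exact .inr ⟨t, t.2, rfl⟩
  obtain ⟨D, _, h', a, b, hh', ha, hb, haF, hbh, hab⟩ := exists_amalgam hF hh
    (fun o : Option T => o.elim z (↑)) (fun o => o.elim c (fun t => e t))
    (fun o => o.elim δ (fun _ => 0)) (by
      rintro (_ | t) (_ | t')
      · simpa using hδ
      · simpa using hz.1 _ (hmem none) _ (hmem (some t'))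
      · simpa using hz.1 _ (hmem (some t)) _ (hmem none)
      · simp [he.1]) (by
      intro i s
      -- One occurrence of `none` already contributes `δ` to the sum; with no occurrence the values
      -- agree exactly.
      by_cases hs : ∃ j, s j = none
      · obtain ⟨j, hj⟩ := hs
        refine (hz.2 i (fun j => ((s j).elim z (↑), (s j).elim c (fun t => e t)))
          (fun j => hmem _)).trans ?_
        have := Finset.single_le_sum (f := fun j => (s j).elim δ (fun _ => 0))
          (fun j _ => hw (s j)) (Finset.mem_univ j)
        simpa only [hj, Option.elim] using this
      · push Not at hs
        choose t ht using fun j => Option.ne_none_iff_exists'.1 (hs j)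
        simp [ht, he.2 i (fun j => (t j : X))])
  obtain ⟨z', hz'⟩ := hQ D h' a hh' ⟨ha, haF⟩ (b c) (insert z T) (hT.insert z) δ' hδ'
  refine ⟨z', ?_, ?_⟩
  · have := hz'.perturb hF hh' (IsStrEmbedding.id F) ⟨hb, hbh⟩ le_rfl
      (R := insert (z', c) ((fun t => (t, e t)) '' T)) ?_
    · simpa using this
    · rintro _ (rfl | ⟨t, ht, rfl⟩)
      · exact ⟨(z', b c), .inl rfl, by simp, by simp⟩
      · refine ⟨(t, a t), .inr ⟨t, .inr ht, rfl⟩, by simp, ?_⟩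
        simpa [dist_comm] using hab (some ⟨t, ht⟩)
  · have h1 := abs_le.1 (hz'.1 (z, a z) (.inr ⟨z, .inl rfl, rfl⟩) (z', b c) (.inl rfl))
    have h2 := hab none
    simp only [Option.elim] at h2 h1
    linarith

/-- In a complete structure, approximate realization implies exact realization. -/
theorem HasApproxPoints.exists_exact {X C : Type u} [PseudoMetricSpace X] [CompleteSpace X]
    [PseudoMetricSpace C] {F : ∀ i, (Fin (n i) → X) → ℝ} (hQ : HasApproxPoints F) (hF : IsLip F)
    {h : ∀ i, (Fin (n i) → C) → ℝ} (hh : IsLip h) {e : X → C} (he : IsStrEmbedding F h e)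
    (c : C) {T : Set X} (hT : T.Finite) :
    ∃ z, IsApproxIso F h 0 (insert (z, c) ((fun t => (t, e t)) '' T)) := by
  let P : ℕ → X → Prop := fun k z =>
    IsApproxIso F h ((1 / 2) ^ k) (insert (z, c) ((fun t => (t, e t)) '' T))
  obtain ⟨z₀, hz₀⟩ : ∃ z, P 0 z := hQ C h e hh he c T hT _ (by positivity)
  -- Successive corrections are summable, so the approximations converge; the error of the limit is
  -- bounded through `perturb` and tends to `0`.
  have step : ∀ k (z : {z // P k z}), ∃ z' : {z // P (k + 1) z},
      dist z.1 z'.1 ≤ 2 * (1 / 2) ^ k := by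
    rintro k ⟨z, hz⟩
    obtain ⟨z', hz', hd⟩ := hQ.exists_closer hF hh he hT (by positivity) hz
      (δ' := (1 / 2) ^ (k + 1)) (by positivity)
    refine ⟨⟨z', hz'⟩, hd.trans ?_⟩
    have : (0 : ℝ) < (1 / 2) ^ k := by positivity
    rw [pow_succ]
    linarith
  choose next hnext using step
  let u : ∀ k, {z // P k z} := fun k => Nat.rec ⟨z₀, hz₀⟩ (fun k z => next k z) k
  have hu : ∀ k, dist (u k).1 (u (k + 1)).1 ≤ 2 * (1 / 2) ^ k := fun k => hnext k (u k)
  obtain ⟨z, hz⟩ := cauchySeq_tendsto_of_complete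
    (cauchySeq_of_le_geometric (1 / 2) 2 (by norm_num) hu)
  refine ⟨z, IsApproxIso.of_tendsto
    (ε := fun k => (1 / 2) ^ k + (4 + 2 * ∑ i, (n i : ℝ)) * dist z (u k).1) ?_ fun k => ?_⟩
  · have h1 := tendsto_pow_atTop_nhds_zero_of_lt_one (r := (1 / 2 : ℝ)) (by norm_num)
      (by norm_num)
    have h2 := (tendsto_const_nhds (x := z)).dist hz
    rw [dist_self] at h2
    simpa using h1.add (h2.const_mul (4 + 2 * ∑ i, (n i : ℝ)))
  · refine (u k).2.perturb hF hh (IsStrEmbedding.id F) (IsStrEmbedding.id h) dist_nonneg ?_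
    rintro _ (rfl | ⟨t, ht, rfl⟩)
    · exact ⟨_, .inl rfl, le_rfl, by simp⟩
    · exact ⟨_, .inr ⟨t, ht, rfl⟩, by simp, by simp⟩

/-! ### The exact extension property. -/

/-- The pairs in `R` match distances and values of `f` and `g`. -/
def IsPartialIso {X Y : Type*} [PseudoMetricSpace X] [PseudoMetricSpace Y]
    (f : ∀ i, (Fin (n i) → X) → ℝ) (g : ∀ i, (Fin (n i) → Y) → ℝ) (R : Set (X × Y)) : Prop :=
  (∀ a ∈ R, ∀ b ∈ R, dist a.1 b.1 = dist a.2 b.2) ∧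
  ∀ i (s : Fin (n i) → X × Y), (∀ j, s j ∈ R) →
    f i (fun j => (s j).1) = g i (fun j => (s j).2)

/-- Finite partial embeddings of arbitrary structures in `(Y, g)` extend to one more point. -/
def HasExtension {Y : Type u} [PseudoMetricSpace Y] (g : ∀ i, (Fin (n i) → Y) → ℝ) : Prop :=
  ∀ (X : Type u) [PseudoMetricSpace X] (f : ∀ i, (Fin (n i) → X) → ℝ), IsLip f →
    ∀ R : Set (X × Y), R.Finite → IsPartialIso f g R → ∀ x,
      ∃ y, IsPartialIso f g (insert (x, y) R)

/-- Amalgamate `Y` with `X` along `R`, and realize the image of the new point exactly over the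
second coordinates of `R`. -/
theorem HasApproxPoints.hasExtension {Y : Type u} [PseudoMetricSpace Y] [CompleteSpace Y]
    [Nonempty Y] {g : ∀ i, (Fin (n i) → Y) → ℝ} (hQ : HasApproxPoints g) (hg : IsLip g)
    (hn : ∀ i, 0 < n i) : HasExtension g := by
  intro X _ f hf R hR hiso x
  obtain ⟨C, _, h, a, b, hh, ha, hb, hag, hbf, hab⟩ : ∃ (C : Type u) (_ : PseudoMetricSpace C)
      (h : ∀ i, (Fin (n i) → C) → ℝ) (a : Y → C) (b : X → C), IsLip h ∧
      (∀ x y, dist (a x) (a y) = dist x y) ∧ (∀ x y, dist (b x) (b y) = dist x y) ∧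
      (∀ i x, h i (fun j => a (x j)) = g i x) ∧ (∀ i x, h i (fun j => b (x j)) = f i x) ∧
      ∀ p ∈ R, dist (a p.2) (b p.1) ≤ 0 := by
    rcases R.eq_empty_or_nonempty with rfl | hne
    · obtain ⟨y⟩ := ‹Nonempty Y›
      -- With nothing to glue along, one long bridge joins `x` to an arbitrary `y`. Positive arity
      -- makes the allowed discrepancy `n i * w` at least `w`.
      let w := ∑ i, |g i (fun _ => y) - f i (fun _ => x)|
      have hw : 0 ≤ w := Finset.sum_nonneg fun _ _ => abs_nonneg _
      obtain ⟨C, _, h, a, b, hh, ha, hb, hag, hbf, -⟩ := exists_amalgam hg hf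
        (fun _ : Unit => y) (fun _ => x) (fun _ => w) (by simpa using hw) (by
          intro i s
          refine (Finset.single_le_sum (f := fun i => |g i (fun _ => y) - f i (fun _ => x)|)
            (fun _ _ => abs_nonneg _) (Finset.mem_univ i)).trans ?_
          simpa using le_mul_of_one_le_left hw (Nat.one_le_cast.2 (hn i)))
      exact ⟨C, _, h, a, b, hh, ha, hb, hag, hbf, by simp⟩
    · have := hR.to_subtype
      have := hne.to_subtype
      obtain ⟨C, _, h, a, b, hh, ha, hb, hag, hbf, hab⟩ := exists_amalgam hg hf
        (fun p : R => p.1.2) (fun p => p.1.1) (fun _ => 0)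
        (fun p q => by simp [hiso.1 p.1 p.2 q.1 q.2])
        (fun i s => by simp [hiso.2 i (fun j => (s j).1) (fun j => (s j).2)])
      exact ⟨C, _, h, a, b, hh, ha, hb, hag, hbf, fun p hp => hab ⟨p, hp⟩⟩
  obtain ⟨y, hy⟩ := hQ.exists_exact hg hh ⟨ha, hag⟩ (b x) (hR.image Prod.snd)
  refine ⟨y, ?_⟩
  have := hy.perturb hg hh (IsStrEmbedding.id g) ⟨hb, hbf⟩ le_rfl
    (R := Prod.swap '' insert (x, y) R) ?_
  · rw [mul_zero, add_zero] at this
    constructor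
    · intro p hp q hq
      exact (sub_eq_zero.1 (abs_nonpos_iff.1
        (this.1 _ (Set.mem_image_of_mem _ hp) _ (Set.mem_image_of_mem _ hq)))).symm
    · intro i s hs
      exact (sub_eq_zero.1 (abs_nonpos_iff.1
        (this.2 i (fun j => (s j).swap) fun j => Set.mem_image_of_mem _ (hs j)))).symm
  · rintro _ ⟨p, rfl | hp, rfl⟩
    · exact ⟨_, .inl rfl, by simp, by simp⟩
    · refine ⟨(p.2, a p.2), .inr ⟨_, ⟨p, hp, rfl⟩, rfl⟩, by simp, ?_⟩
      simpa [dist_comm] using hab p hp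

theorem HasApproxPoints.exists_completion {S : Type u} [PseudoMetricSpace S] [Countable S]
    [Nonempty S] {f : ∀ i, (Fin (n i) → S) → ℝ} (hQ : HasApproxPoints f) (hf : IsLip f)
    (hn : ∀ i, 0 < n i) :
    ∃ (Y : Type u) (_ : MetricSpace Y) (g : ∀ i, (Fin (n i) → Y) → ℝ), CompleteSpace Y ∧
      TopologicalSpace.SeparableSpace Y ∧ IsLip g ∧ HasExtension g := by
  have ext := fun i => exists_lipschitz_extension
    (fun (x : Fin (n i) → S) j => (x j : UniformSpace.Completion S))
    (f i) (hf i).1 (by simpa only [UniformSpace.Completion.dist_eq] using (hf i).2)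
  choose g hg0 hgl hgf using ext
  have hg : IsLip g := fun i => ⟨hg0 i, hgl i⟩
  have hdense := UniformSpace.Completion.denseRange_coe (α := S)
  have : Nonempty (UniformSpace.Completion S) := ‹Nonempty S›.map (↑)
  refine ⟨UniformSpace.Completion S, inferInstance, g, inferInstance,
    hdense.separableSpace (UniformSpace.Completion.continuous_coe _), hg, ?_⟩
  exact (hQ.of_denseRange hg (ι := (↑)) ⟨UniformSpace.Completion.dist_eq, hgf⟩
    hdense).hasExtension hg hn

/-- For positive arities there is a complete separable structure with the extension property. -/
theorem exists_hasExtension (n : Fin m → ℕ) (hn : ∀ i, 0 < n i) :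
    ∃ (Y : Type u) (_ : MetricSpace Y) (g : ∀ i, (Fin (n i) → Y) → ℝ), CompleteSpace Y ∧
      TopologicalSpace.SeparableSpace Y ∧ IsLip g ∧ HasExtension g := by
  obtain ⟨inst, f, hf, hQ⟩ := exists_hasApproxPoints n (ULift.{u} ℕ)
  exact @HasApproxPoints.exists_completion m n _ inst _ _ f hQ hf hn

end Approx

/-! ### Back-and-forth. -/

section BackAndForth

variable {m : ℕ} {n : Fin m → ℕ}

theorem IsLip.continuous {X : Type*} [PseudoMetricSpace X] {f : ∀ i, (Fin (n i) → X) → ℝ}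
    (hf : IsLip f) (i : Fin m) : Continuous (f i) := by
  refine continuous_iff_continuousAt.2 fun x => tendsto_iff_dist_tendsto_zero.2 ?_
  refine squeeze_zero (fun _ => dist_nonneg) (fun y => hf.abs_sub_le i y x) ?_
  have : Continuous fun y : Fin (n i) → X => ∑ j, dist (y j) (x j) := by fun_prop
  simpa using this.tendsto x

section PartialIso

variable {X Y : Type*} [PseudoMetricSpace X] [PseudoMetricSpace Y]
  {f : ∀ i, (Fin (n i) → X) → ℝ} {g : ∀ i, (Fin (n i) → Y) → ℝ} {R : Set (X × Y)}

theorem IsPartialIso.mono {R' : Set (X × Y)} (h : IsPartialIso f g R) (hR : R' ⊆ R) :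
    IsPartialIso f g R' :=
  ⟨fun a ha b hb => h.1 a (hR ha) b (hR hb), fun i s hs => h.2 i s fun j => hR (hs j)⟩

theorem IsPartialIso.swap (h : IsPartialIso f g R) : IsPartialIso g f (Prod.swap '' R) := by
  constructor
  · rintro _ ⟨a, ha, rfl⟩ _ ⟨b, hb, rfl⟩
    exact (h.1 a ha b hb).symm
  · intro i s hs
    choose t ht hts using hs
    simpa [← hts] using (h.2 i t ht).symm

/-- Positive arity matters: the empty tuple would satisfy the membership condition vacuously and
impose an equality of values. -/
theorem isPartialIso_empty (hn : ∀ i, 0 < n i) : IsPartialIso f g ∅ :=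
  ⟨fun _ h => h.elim, fun i _ h => (h ⟨0, hn i⟩).elim⟩

theorem IsPartialIso.closure (h : IsPartialIso f g R) (hf : IsLip f) (hg : IsLip g) :
    IsPartialIso f g (closure R) := by
  constructor
  · intro a ha b hb
    have hc : IsClosed {p : (X × Y) × (X × Y) | dist p.1.1 p.2.1 = dist p.1.2 p.2.2} :=
      isClosed_eq (by fun_prop) (by fun_prop)
    have : R ×ˢ R ⊆ {p : (X × Y) × (X × Y) | dist p.1.1 p.2.1 = dist p.1.2 p.2.2} :=
      fun p hp => h.1 _ hp.1 _ hp.2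
    have hab : (a, b) ∈ _root_.closure (R ×ˢ R) := by
      rw [closure_prod_eq]
      exact ⟨ha, hb⟩
    exact closure_minimal this hc hab
  · intro i s hs
    have hc : IsClosed {s : Fin (n i) → X × Y |
        f i (fun j => (s j).1) = g i (fun j => (s j).2)} :=
      isClosed_eq ((hf.continuous i).comp (by fun_prop)) ((hg.continuous i).comp (by fun_prop))
    have hs' : s ∈ _root_.closure (Set.univ.pi fun _ : Fin (n i) => R) := by
      rw [closure_pi_set]
      exact fun j _ => hs j
    have hsub : (Set.univ.pi fun _ : Fin (n i) => R) ⊆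
        {s | f i (fun j => (s j).1) = g i (fun j => (s j).2)} :=
      fun t ht => h.2 i t fun j => ht j trivial
    exact closure_minimal hsub hc hs'

/-- Partners of a convergent sequence form a Cauchy sequence because `R` matches distances. -/
theorem IsPartialIso.exists_mem_closure [CompleteSpace Y] (h : IsPartialIso f g R)
    (hd : Dense (Prod.fst '' R)) (x : X) : ∃ y, (x, y) ∈ _root_.closure R := by
  obtain ⟨u, hu, hux⟩ := mem_closure_iff_seq_limit.1 (hd x)
  choose r hr hru using hu
  have hc : CauchySeq fun k => (r k).2 := by
    rw [Metric.cauchySeq_iff']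
    intro ε hε
    obtain ⟨N, hN⟩ := Metric.cauchySeq_iff'.1 hux.cauchySeq ε hε
    refine ⟨N, fun k hk => ?_⟩
    rw [← h.1 _ (hr k) _ (hr N), hru, hru]
    exact hN k hk
  obtain ⟨y, hy⟩ := cauchySeq_tendsto_of_complete hc
  refine ⟨y, mem_closure_of_tendsto (f := r) (b := Filter.atTop) ?_ (.of_forall hr)⟩
  rw [Prod.tendsto_iff]
  simpa only [hru] using And.intro hux hy

theorem IsPartialIso.exists_embedding [CompleteSpace Y] (h : IsPartialIso f g R) (hf : IsLip f)
    (hg : IsLip g) (hd : Dense (Prod.fst '' R)) :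
    ∃ ι : X → Y, Isometry ι ∧ (∀ i x, g i (fun j => ι (x j)) = f i x) ∧
      ∀ x, (x, ι x) ∈ _root_.closure R := by
  choose ι hι using h.exists_mem_closure hd
  have hc := h.closure hf hg
  exact ⟨ι, Isometry.of_dist_eq fun x y => (hc.1 _ (hι x) _ (hι y)).symm,
    fun i x => (hc.2 i (fun j => (x j, ι (x j))) fun j => hι (x j)).symm, hι⟩

end PartialIso

theorem IsPartialIso.eq_of_mem {X Y : Type*} [PseudoMetricSpace X] [MetricSpace Y]
    {f : ∀ i, (Fin (n i) → X) → ℝ} {g : ∀ i, (Fin (n i) → Y) → ℝ} {R : Set (X × Y)}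
    (h : IsPartialIso f g R) {x : X} {y y' : Y} (hy : (x, y) ∈ R) (hy' : (x, y') ∈ R) :
    y = y' := by
  simpa using (h.1 _ hy _ hy').symm

/-- The closure of `R` is the graph of the isomorphism: density of the first projection makes it
total, density of the second makes it surjective. -/
theorem IsPartialIso.exists_isometryEquiv {X Y : Type*} [MetricSpace X] [MetricSpace Y]
    [CompleteSpace X] [CompleteSpace Y] {f : ∀ i, (Fin (n i) → X) → ℝ}
    {g : ∀ i, (Fin (n i) → Y) → ℝ} {R : Set (X × Y)} (h : IsPartialIso f g R) (hf : IsLip f)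
    (hg : IsLip g) (hd : Dense (Prod.fst '' R)) (hd' : Dense (Prod.snd '' R)) :
    ∃ Φ : X ≃ᵢ Y, (∀ i x, g i (fun j => Φ (x j)) = f i x) ∧ ∀ p ∈ R, Φ p.1 = p.2 := by
  obtain ⟨ι, hι, hιf, hιR⟩ := h.exists_embedding hf hg hd
  have hc := h.closure hf hg
  have hsurj : Function.Surjective ι := fun y => by
    obtain ⟨x, hx⟩ := h.swap.exists_mem_closure (by simpa [Set.image_image] using hd') y
    have hx' : (x, y) ∈ _root_.closure R := by
      have := image_closure_subset_closure_image (continuous_swap (X := Y) (Y := X))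
        (Set.mem_image_of_mem _ hx)
      simpa [Set.image_image] using this
    exact ⟨x, hc.eq_of_mem (hιR x) hx'⟩
  refine ⟨⟨Equiv.ofBijective ι ⟨hι.injective, hsurj⟩, hι⟩, hιf, fun p hp => ?_⟩
  exact hc.eq_of_mem (hιR p.1) (subset_closure hp)

/-- Countably many one-step extension requirements on finite partial isomorphisms can be met
simultaneously. -/
theorem IsPartialIso.exists_generic {X Y : Type*} [PseudoMetricSpace X] [PseudoMetricSpace Y]
    {f : ∀ i, (Fin (n i) → X) → ℝ} {g : ∀ i, (Fin (n i) → Y) → ℝ} {ι : Type*} [Countable ι]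
    (P : ι → Set (X × Y))
    (hP : ∀ k (R : Set (X × Y)), R.Finite → IsPartialIso f g R →
      ∃ p ∈ P k, IsPartialIso f g (insert p R))
    {R : Set (X × Y)} (hR : R.Finite) (h : IsPartialIso f g R) :
    ∃ R', R ⊆ R' ∧ IsPartialIso f g R' ∧ ∀ k, ∃ p ∈ P k, p ∈ R' := by
  let _ := Encodable.ofCountable ι
  let Q := {R : Set (X × Y) // R.Finite ∧ IsPartialIso f g R}
  let D : ι → Order.Cofinal Q := fun k =>
    { carrier := {R | ∃ p ∈ P k, p ∈ R.1}
      isCofinal := fun R => by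
        obtain ⟨p, hp, h⟩ := hP k R.1 R.2.1 R.2.2
        exact ⟨⟨insert p R.1, R.2.1.insert p, h⟩, ⟨p, hp, .inl rfl⟩, Set.subset_insert _ _⟩ }
  -- The Rasiowa–Sikorski argument: an ideal of finite partial isomorphisms that meets every
  -- requirement. Each condition on its union involves finitely many pairs, hence a single member of
  -- the ideal.
  let I := Order.idealOfCofinals (⟨R, hR, h⟩ : Q) D
  have key : ∀ {κ : Type} [Finite κ] (s : κ → X × Y), (∀ j, ∃ R ∈ I, s j ∈ R.1) →
      ∃ R ∈ I, ∀ j, s j ∈ R.1 := by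
    intro κ _ s hs
    choose T hT hsT using hs
    have hdir : Directed (· ≤ ·) (Subtype.val : I → Q) := I.directed.directed_val
    have : Nonempty I := I.nonempty.to_subtype
    obtain ⟨Z, hZ⟩ := hdir.finite_le (fun j => (⟨T j, hT j⟩ : I))
    exact ⟨Z.1, Z.2, fun j => hZ j (hsT j)⟩
  refine ⟨⋃ T ∈ I, T.1, ?_, ⟨fun a ha b hb => ?_, fun i s hs => ?_⟩, fun k => ?_⟩
  · exact Set.subset_biUnion_of_mem (u := fun T : Q => T.1)
      (Order.mem_idealOfCofinals (⟨R, hR, h⟩ : Q) D)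
  · simp only [Set.mem_iUnion, exists_prop] at ha hb
    obtain ⟨T, -, hT⟩ := key ![a, b] (Fin.forall_fin_two.2 ⟨ha, hb⟩)
    exact T.2.2.1 a (hT 0) b (hT 1)
  · simp only [Set.mem_iUnion, exists_prop] at hs
    obtain ⟨T, -, hT⟩ := key s hs
    exact T.2.2.2 i s hT
  · obtain ⟨T, ⟨p, hp, hpT⟩, hT⟩ := Order.cofinal_meets_idealOfCofinals (⟨R, hR, h⟩ : Q) D k
    exact ⟨p, hp, Set.mem_biUnion (s := {T | T ∈ I}) hT hpT⟩

theorem HasExtension.exists_forth {X Y : Type u} [PseudoMetricSpace X] [PseudoMetricSpace Y]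
    {f : ∀ i, (Fin (n i) → X) → ℝ} {g : ∀ i, (Fin (n i) → Y) → ℝ} (hg : HasExtension g)
    (hf : IsLip f) {R : Set (X × Y)} (hR : R.Finite) (h : IsPartialIso f g R) {s : Set X}
    (hs : s.Countable) :
    ∃ R', R ⊆ R' ∧ IsPartialIso f g R' ∧ ∀ x ∈ s, ∃ y, (x, y) ∈ R' := by
  have := hs.to_subtype
  obtain ⟨R', hRR', hR', hs'⟩ := IsPartialIso.exists_generic (fun x : s => {p : X × Y | p.1 = x})
    (fun x R hR h => by
      obtain ⟨y, hy⟩ := hg X f hf R hR h x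
      exact ⟨(x, y), rfl, hy⟩) hR h
  refine ⟨R', hRR', hR', fun x hx => ?_⟩
  obtain ⟨⟨x', y⟩, rfl, hp⟩ := hs' ⟨x, hx⟩
  exact ⟨y, hp⟩

/-- Separable structures embed in complete structures with the extension property. -/
theorem HasExtension.exists_embedding {X Y : Type u} [PseudoMetricSpace X]
    [TopologicalSpace.SeparableSpace X] [PseudoMetricSpace Y] [CompleteSpace Y]
    {f : ∀ i, (Fin (n i) → X) → ℝ} {g : ∀ i, (Fin (n i) → Y) → ℝ} (h : HasExtension g)
    (hf : IsLip f) (hg : IsLip g) (hn : ∀ i, 0 < n i) :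
    ∃ ι : X → Y, Isometry ι ∧ ∀ i x, g i (fun j => ι (x j)) = f i x := by
  obtain ⟨s, hs, hsd⟩ := TopologicalSpace.exists_countable_dense X
  obtain ⟨R, -, hR, hsR⟩ := h.exists_forth hf Set.finite_empty (isPartialIso_empty hn) hs
  obtain ⟨ι, hι, hιf, -⟩ := hR.exists_embedding hf hg (hsd.mono fun x hx => by
    obtain ⟨y, hy⟩ := hsR x hx
    exact ⟨_, hy, rfl⟩)
  exact ⟨ι, hι, hιf⟩

/-- Back-and-forth: finite partial isomorphisms between complete separable structures with the
extension property extend to isomorphisms. -/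
theorem HasExtension.exists_isometryEquiv {X Y : Type u} [MetricSpace X] [CompleteSpace X]
    [TopologicalSpace.SeparableSpace X] [MetricSpace Y] [CompleteSpace Y]
    [TopologicalSpace.SeparableSpace Y] {f : ∀ i, (Fin (n i) → X) → ℝ}
    {g : ∀ i, (Fin (n i) → Y) → ℝ} (hf : IsLip f) (hg : IsLip g) (hfe : HasExtension f)
    (hge : HasExtension g) {R : Set (X × Y)} (hR : R.Finite) (h : IsPartialIso f g R) :
    ∃ Φ : X ≃ᵢ Y, (∀ i x, g i (fun j => Φ (x j)) = f i x) ∧ ∀ p ∈ R, Φ p.1 = p.2 := by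
  obtain ⟨s, hs, hsd⟩ := TopologicalSpace.exists_countable_dense X
  obtain ⟨t, ht, htd⟩ := TopologicalSpace.exists_countable_dense Y
  have := hs.to_subtype
  have := ht.to_subtype
  obtain ⟨R', hRR', hR', hst⟩ := IsPartialIso.exists_generic
    (Sum.elim (fun x : s => {p : X × Y | p.1 = x}) (fun y : t => {p | p.2 = y})) (by
      rintro (x | y) R hR h
      · obtain ⟨y, hy⟩ := hge X f hf R hR h x
        exact ⟨(x, y), rfl, hy⟩
      · obtain ⟨x, hx⟩ := hfe Y g hg _ (hR.image _) h.swap y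
        refine ⟨(x, y), rfl, ?_⟩
        simpa [Set.image_insert_eq, Set.image_image] using hx.swap) hR h
  obtain ⟨Φ, hΦ, hΦR⟩ := hR'.exists_isometryEquiv hf hg
    (hsd.mono fun x hx => by
      obtain ⟨p, hp, hpR⟩ := hst (.inl ⟨x, hx⟩)
      exact ⟨p, hpR, hp⟩)
    (htd.mono fun y hy => by
      obtain ⟨p, hp, hpR⟩ := hst (.inr ⟨y, hy⟩)
      exact ⟨p, hpR, hp⟩)
  exact ⟨Φ, hΦ, fun p hp => hΦR p (hRR' hp)⟩

end BackAndForth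

/-! ### Distances from relations. -/

section RelDist

variable {X : Type u} [MetricSpace X] {k : ℕ} {R : Set (Fin k → X)}

theorem relDist_le_add (R : Set (Fin k → X)) (x y : Fin k → X) :
    relDist R x ≤ relDist R y + ∑ j, edist (x j) (y j) := by
  simp only [relDist, ENNReal.iInf_add]
  refine le_iInf₂ fun z hz => (iInf₂_le z hz).trans ?_
  rw [add_comm, ← Finset.sum_add_distrib]
  gcongr with j
  exact edist_triangle _ _ _

theorem relDist_ne_top (hR : R.Nonempty) (x : Fin k → X) : relDist R x ≠ ∞ := by
  obtain ⟨y, hy⟩ := hR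
  exact ne_top_of_le_ne_top (ENNReal.sum_ne_top.2 fun j _ => edist_ne_top (x j) (y j))
    (iInf₂_le y hy)

theorem relDist_eq_top_of_empty (x : Fin k → X) : relDist ∅ x = ∞ := by
  simp [relDist]

theorem nonempty_of_relDist_ne_top {x : Fin k → X} (h : relDist R x ≠ ∞) : R.Nonempty := by
  by_contra hR
  rw [Set.not_nonempty_iff_eq_empty.1 hR] at h
  exact h (relDist_eq_top_of_empty x)

theorem relDist_eq_zero_iff (hR : IsClosed R) {x : Fin k → X} : relDist R x = 0 ↔ x ∈ R := by
  constructor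
  · intro h
    rw [← hR.closure_eq, EMetric.mem_closure_iff]
    intro ε hε
    rw [← h] at hε
    simp only [relDist, iInf_lt_iff] at hε
    obtain ⟨y, hy, hxy⟩ := hε
    refine ⟨y, hy, lt_of_le_of_lt ?_ hxy⟩
    -- Closedness refers to the sup metric on the function type, which is bounded by the sum metric.
    exact edist_pi_le_iff.2 fun j => Finset.single_le_sum (f := fun j => edist (x j) (y j))
      (fun _ _ => zero_le) (Finset.mem_univ j)
  · intro h
    exact le_antisymm ((iInf₂_le x h).trans (by simp)) zero_le

theorem sum_edist_eq_ofReal (x y : Fin k → X) :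
    ∑ j, edist (x j) (y j) = ENNReal.ofReal (∑ j, dist (x j) (y j)) := by
  rw [ENNReal.ofReal_sum_of_nonneg fun _ _ => dist_nonneg]
  simp [edist_dist]

open Classical in
/-- The real-valued distance from a relation, with the value `1` for the empty relation. -/
noncomputable def relValue (R : Set (Fin k → X)) (x : Fin k → X) : ℝ :=
  if R.Nonempty then (relDist R x).toReal else 1

theorem relValue_nonneg (R : Set (Fin k → X)) (x : Fin k → X) : 0 ≤ relValue R x := by
  unfold relValue
  split_ifs <;> simp

theorem ofReal_relValue (hR : R.Nonempty) (x : Fin k → X) :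
    ENNReal.ofReal (relValue R x) = relDist R x := by
  rw [relValue, if_pos hR, ENNReal.ofReal_toReal (relDist_ne_top hR x)]

theorem relValue_le_add (R : Set (Fin k → X)) (x y : Fin k → X) :
    relValue R x ≤ relValue R y + ∑ j, dist (x j) (y j) := by
  have h0 : 0 ≤ ∑ j, dist (x j) (y j) := Finset.sum_nonneg fun _ _ => dist_nonneg
  by_cases hR : R.Nonempty
  · rw [← ENNReal.ofReal_le_ofReal_iff (add_nonneg (relValue_nonneg R y) h0),
      ENNReal.ofReal_add (relValue_nonneg R y) h0, ofReal_relValue hR, ofReal_relValue hR,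
      ← sum_edist_eq_ofReal]
    exact relDist_le_add R x y
  · simpa [relValue, hR] using h0

theorem relValue_eq_zero_iff (hR : IsClosed R) {x : Fin k → X} : relValue R x = 0 ↔ x ∈ R := by
  by_cases hne : R.Nonempty
  · rw [← relDist_eq_zero_iff hR, relValue, if_pos hne, ENNReal.toReal_eq_zero_iff]
    simp [relDist_ne_top hne]
  · simp [relValue, Set.not_nonempty_iff_eq_empty.1 hne]

/-- Automorphisms are only required to preserve membership; surjectivity yields the preservation of
distances. -/
theorem relDist_equiv {R : Set (Fin k → X)} (Φ : X ≃ᵢ X)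
    (hΦ : ∀ x : Fin k → X, (fun j => Φ (x j)) ∈ R ↔ x ∈ R) (x : Fin k → X) :
    relDist R (fun j => Φ (x j)) = relDist R x := by
  refine le_antisymm (le_iInf₂ fun y hy => ?_) (le_iInf₂ fun y hy => ?_)
  · refine (iInf₂_le (fun j => Φ (y j)) ((hΦ y).2 hy)).trans ?_
    simp [Φ.isometry.edist_eq]
  · refine (iInf₂_le (fun j => Φ.symm (y j)) ((hΦ _).1 (by simpa using hy))).trans ?_
    refine Finset.sum_le_sum fun j _ => ?_
    rw [← Φ.isometry.edist_eq]
    simp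

end RelDist

/-! ### Universality, ultrahomogeneity and the converse. -/

section Main

variable {m : ℕ} {n : Fin m → ℕ}

theorem isLip_relValue {X : Type u} [MetricSpace X] (G : ∀ i, Set (Fin (n i) → X)) :
    IsLip fun i => relValue (G i) :=
  fun i => ⟨relValue_nonneg (G i), relValue_le_add (G i)⟩

/-- In a structure with the extension property, the functions are the distances from their zero
sets. -/
theorem HasExtension.exists_zero {X : Type u} [PseudoMetricSpace X]
    {f : ∀ i, (Fin (n i) → X) → ℝ} (h : HasExtension f) (hf : IsLip f) (hn : ∀ i, 0 < n i)
    (i : Fin m) (x : Fin (n i) → X) :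
    ∃ y, f i y = 0 ∧ ∑ j, dist (x j) (y j) ≤ f i x := by
  have hi : (n i : ℝ) ≠ 0 := (Nat.cast_pos.2 (hn i)).ne'
  have : NeZero (n i) := ⟨(hn i).ne'⟩
  let δ : ℝ := f i x / n i
  have hδ : 0 ≤ δ := div_nonneg ((hf i).1 x) (Nat.cast_nonneg _)
  -- An abstract copy of the tuple `x`, to be placed with each entry within `δ` of the original.
  -- Such a displacement allows the `k`th function to drop by `n k * δ`; truncating at `0` keeps it
  -- non-negative, and for `k = i` the copy of the tuple gets the value exactly `0`.
  let _ : PseudoMetricSpace (ULift.{u} (Fin (n i))) := .induced (fun s => x s.down) inferInstance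
  let g : ∀ k, (Fin (n k) → ULift.{u} (Fin (n i))) → ℝ := fun k s =>
    max (f k (fun j => x (s j).down) - n k * δ) 0
  have hg : IsLip g := fun k => ⟨fun s => le_max_right _ _, fun s t => by
    have h1 := (hf k).2 (fun j => x (s j).down) (fun j => x (t j).down)
    have h2 : 0 ≤ ∑ j, dist (s j) (t j) := Finset.sum_nonneg fun _ _ => dist_nonneg
    change _ ≤ _ + ∑ j, dist (s j) (t j) at h1
    refine max_le ?_ (add_nonneg (le_max_right _ _) h2)
    linarith [le_max_left (f k (fun j => x (t j).down) - n k * δ) 0]⟩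
  obtain ⟨C, _, c, a, b, hc, ha, hb, hac, hbc, hab⟩ := exists_amalgam hf hg x ULift.up
    (fun _ => δ) (fun j k => by
      change |dist (x j) (x k) - dist (x j) (x k)| ≤ _
      simpa using add_nonneg hδ hδ) (fun k s => by
      have h0 := (hf k).1 (fun j => x (s j))
      have h1 : 0 ≤ n k * δ := mul_nonneg (Nat.cast_nonneg _) hδ
      simp only [g, Finset.sum_const, Finset.card_univ, Fintype.card_fin, nsmul_eq_mul]
      rw [abs_le]
      rcases max_cases (f k (fun j => x (s j)) - n k * δ) 0 with ⟨h2, h3⟩ | ⟨h2, h3⟩ <;>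
        rw [h2] <;> constructor <;> linarith)
  have hfin : (Set.range fun j => (a (x j), x j)).Finite := Set.finite_range _
  obtain ⟨R, hR, hiso, hdom⟩ := h.exists_forth hc hfin (by
      constructor
      · rintro _ ⟨j, rfl⟩ _ ⟨k, rfl⟩
        exact ha _ _
      · intro k s hs
        choose t ht using hs
        simpa [← ht] using hac k (fun j => x (t j)))
    (Set.countable_range fun j : Fin (n i) => b (ULift.up j))
  choose y hy using fun j => hdom _ ⟨j, rfl⟩
  refine ⟨y, ?_, ?_⟩
  · rw [← hiso.2 i (fun j => (b (ULift.up j), y j)) hy, hbc i ULift.up]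
    simp [g, δ, mul_div_cancel₀ _ hi]
  · have : ∀ j, dist (x j) (y j) ≤ δ := fun j => by
      rw [← hiso.1 _ (hR ⟨j, rfl⟩) _ (hy j)]
      exact hab j
    refine (Finset.sum_le_card_nsmul Finset.univ _ δ fun j _ => this j).trans ?_
    simp [δ, mul_div_cancel₀ _ hi]

theorem HasExtension.nonempty {X : Type u} [PseudoMetricSpace X]
    {f : ∀ i, (Fin (n i) → X) → ℝ} (h : HasExtension f) (hn : ∀ i, 0 < n i) : Nonempty X := by
  obtain ⟨y, -⟩ := h PUnit (fun _ _ => 0) (fun i => ⟨fun _ => le_rfl, by simp⟩) ∅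
    Set.finite_empty (isPartialIso_empty hn) PUnit.unit
  exact ⟨y⟩

/-- One inequality is `exists_zero`, the other is the Lipschitz condition at a zero. -/
theorem HasExtension.relDist_eq {X : Type u} [MetricSpace X]
    {f : ∀ i, (Fin (n i) → X) → ℝ} (h : HasExtension f) (hf : IsLip f) (hn : ∀ i, 0 < n i)
    (i : Fin m) (x : Fin (n i) → X) : relDist {y | f i y = 0} x = ENNReal.ofReal (f i x) := by
  refine le_antisymm ?_ (le_iInf₂ fun y hy => ?_)
  · obtain ⟨y, hy, hxy⟩ := h.exists_zero hf hn i x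
    refine (iInf₂_le y hy).trans ?_
    rw [sum_edist_eq_ofReal]
    exact ENNReal.ofReal_le_ofReal hxy
  · rw [sum_edist_eq_ofReal]
    refine ENNReal.ofReal_le_ofReal (((hf i).2 x y).trans ?_)
    rw [show f i y = 0 from hy, zero_add]

/-- Embed the structure of the functions `relValue`. An empty relation has constant value `1`, so
its image avoids the zero set. -/
theorem HasExtension.isUniversalStructure {X : Type u} [MetricSpace X] [CompleteSpace X]
    {f : ∀ i, (Fin (n i) → X) → ℝ} (h : HasExtension f) (hf : IsLip f) (hn : ∀ i, 0 < n i) :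
    IsUniversalStructure n fun i => {y | f i y = 0} := by
  intro Z _ _ _ G hG
  obtain ⟨ι, hι, hιf⟩ := h.exists_embedding (isLip_relValue G) hf hn
  refine ⟨ι, hι, fun i x => ?_, fun i hi x => ?_⟩
  · rw [Set.mem_ofPred_eq, hιf, relValue_eq_zero_iff (hG i)]
  · rw [h.relDist_eq hf hn, hιf, ofReal_relValue hi]

/-- As the functions are the distances from their zero sets, the hypothesis on `φ` says that its
graph is a finite partial isomorphism. -/
theorem HasExtension.isUltrahomogeneousStructure {X : Type u} [MetricSpace X] [CompleteSpace X]
    [TopologicalSpace.SeparableSpace X] {f : ∀ i, (Fin (n i) → X) → ℝ} (h : HasExtension f)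
    (hf : IsLip f) (hn : ∀ i, 0 < n i) :
    IsUltrahomogeneousStructure n fun i => {y | f i y = 0} := by
  intro A hA φ hφ hφf
  have := hA.to_subtype
  obtain ⟨Φ, hΦ, hΦA⟩ := HasExtension.exists_isometryEquiv hf hf h h
    (Set.finite_range fun a : A => ((a : X), φ a)) (by
      constructor
      · rintro _ ⟨a, rfl⟩ _ ⟨b, rfl⟩
        exact (hφ.dist_eq a b).symm
      · intro i s hs
        choose t ht using hs
        have := hφf i t
        rw [h.relDist_eq hf hn, h.relDist_eq hf hn, ENNReal.ofReal_eq_ofReal_iff ((hf i).1 _)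
          ((hf i).1 _)] at this
        simpa [← ht] using this.symm)
  refine ⟨Φ, fun i x => ?_, fun a => hΦA _ ⟨a, rfl⟩⟩
  rw [Set.mem_ofPred_eq, hΦ, Set.mem_ofPred_eq]

/-- A universal and ultrahomogeneous structure has the extension property. -/
theorem HasExtension.of_universal_of_ultrahomogeneous {U V : Type u} [MetricSpace U]
    [CompleteSpace U] [TopologicalSpace.SeparableSpace U] [MetricSpace V]
    {f : ∀ i, (Fin (n i) → U) → ℝ} (h : HasExtension f) (hf : IsLip f) (hn : ∀ i, 0 < n i)
    {G : ∀ i, Set (Fin (n i) → V)} (hGu : IsUniversalStructure n G)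
    (hGh : IsUltrahomogeneousStructure n G) :
    (∀ i, (G i).Nonempty) ∧ HasExtension fun i => relValue (G i) := by
  obtain ⟨u₀⟩ := h.nonempty hn
  -- The structure with the extension property is itself embedded in `V`. Its zero sets are
  -- non-empty, so universality preserves the distances from them, that is, the functions `f`.
  obtain ⟨ι, hι, -, hιG⟩ := hGu U (fun i => {y | f i y = 0})
    fun i => isClosed_eq (hf.continuous i) continuous_const
  have hFne : ∀ i, {y | f i y = 0}.Nonempty := fun i =>
    nonempty_of_relDist_ne_top (x := fun _ => u₀)
      (by rw [h.relDist_eq hf hn]; exact ENNReal.ofReal_ne_top)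
  have hG : ∀ i, (G i).Nonempty := fun i =>
    nonempty_of_relDist_ne_top (x := fun _ => ι u₀)
      (by rw [hιG i (hFne i) (fun _ => u₀)]; exact relDist_ne_top (hFne i) _)
  have hv : ∀ i x, relValue (G i) (fun j => ι (x j)) = f i x := fun i x => by
    rw [relValue, if_pos (hG i), hιG i (hFne i), h.relDist_eq hf hn,
      ENNReal.toReal_ofReal ((hf i).1 x)]
  refine ⟨hG, fun X _ g hg R hR hiso x => ?_⟩
  -- A copy `e` in `U` of the finite configuration, including the new point `x`. Ultrahomogeneity
  -- will move its image under `ι` so that the old points land where `R` puts them; the image of `x`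
  -- is then the required point.
  obtain ⟨R', -, hR', hdom⟩ := h.exists_forth hg Set.finite_empty (isPartialIso_empty hn)
    ((hR.image Prod.fst).insert x).countable
  have : Nonempty U := ⟨u₀⟩
  choose! e he using hdom
  have heR : ∀ p ∈ R, (p.1, e p.1) ∈ R' := fun p hp => he p.1 (.inr ⟨p, hp, rfl⟩)
  have hA : ((fun p : X × V => ι (e p.1)) '' R).Finite := hR.image _
  choose r hr hre using fun a : (fun p : X × V => ι (e p.1)) '' R => a.2
  obtain ⟨Φ, hΦG, hΦA⟩ := hGh _ hA (fun a => (r a).2)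
    (Isometry.of_dist_eq fun a b => by
      rw [← hiso.1 _ (hr a) _ (hr b), hR'.1 _ (heR _ (hr a)) _ (heR _ (hr b)), Subtype.dist_eq,
        ← hre a, ← hre b, hι.dist_eq])
    (fun i s => by
      rw [← ofReal_relValue (hG i), ← ofReal_relValue (hG i)]
      congr 1
      refine (hiso.2 i (fun j => r (s j)) (fun j => hr (s j))).symm.trans ?_
      simp only [← hre]
      rw [hv i (fun j => e (r (s j)).1)]
      exact hR'.2 i (fun j => ((r (s j)).1, e (r (s j)).1)) fun j => heR _ (hr _))
  have hΦR : ∀ p ∈ R, Φ (ι (e p.1)) = p.2 := fun p hp => by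
    have h1 := hΦA ⟨_, p, hp, rfl⟩
    rw [h1]
    -- The chosen preimage may differ from `p`, since `X` is only pseudometric, but their partners
    -- in `V` are at distance zero.
    refine eq_of_dist_eq_zero ?_
    rw [← hiso.1 _ (hr _) _ hp, hR'.1 _ (heR _ (hr _)) _ (heR _ hp), ← hι.dist_eq]
    exact dist_eq_zero.2 (hre ⟨_, p, hp, rfl⟩)
  refine ⟨Φ (ι (e x)), ?_⟩
  have hall : ∀ p ∈ insert (x, Φ (ι (e x))) R, (p.1, e p.1) ∈ R' ∧ p.2 = Φ (ι (e p.1)) := by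
    rintro p (rfl | hp)
    · exact ⟨he x (.inl rfl), rfl⟩
    · exact ⟨heR p hp, (hΦR p hp).symm⟩
  constructor
  · intro p hp q hq
    rw [(hall p hp).2, (hall q hq).2, Φ.isometry.dist_eq, hι.dist_eq]
    exact hR'.1 _ (hall p hp).1 _ (hall q hq).1
  · intro i s hs
    have h1 := hR'.2 i (fun j => ((s j).1, e (s j).1)) fun j => (hall _ (hs j)).1
    refine h1.trans ((hv i (fun j => e (s j).1)).symm.trans ?_)
    have h2 : (fun j => (s j).2) = fun j => Φ (ι (e (s j).1)) :=
      funext fun j => (hall _ (hs j)).2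
    simp only [h2, relValue, if_pos (hG i)]
    rw [relDist_equiv Φ (hΦG i) (fun j => ι (e (s j).1))]

/-! ### The Urysohn space. -/

/-- Pull the functions back to `A` and extend them to `B` by McShane; the metric extension problem
becomes an extension problem for structures. -/
theorem HasExtension.isUrysohnSpace {U : Type u} [MetricSpace U] [CompleteSpace U]
    [TopologicalSpace.SeparableSpace U] {f : ∀ i, (Fin (n i) → U) → ℝ} (h : HasExtension f)
    (hf : IsLip f) : IsUrysohnSpace U := by
  refine ⟨inferInstance, inferInstance, fun B _ _ A φ hφ => ?_⟩
  have ext := fun i => exists_lipschitz_extension (fun (x : Fin (n i) → A) j => (x j : B))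
    (fun x => f i fun j => φ (x j)) (fun x => (hf i).1 _) (fun x y => by
      simpa only [hφ.dist_eq, Subtype.dist_eq] using (hf i).2 (fun j => φ (x j)) (fun j => φ (y j)))
  choose g hg0 hgl hgf using ext
  obtain ⟨R, hR, hiso, hdom⟩ := h.exists_forth (fun i => ⟨hg0 i, hgl i⟩)
    (Set.finite_range fun a : A => ((a : B), φ a)) (by
      constructor
      · rintro _ ⟨a, rfl⟩ _ ⟨b, rfl⟩
        exact (hφ.dist_eq a b).symm
      · intro i s hs
        choose t ht using hs
        simpa [← ht] using hgf i t) (Set.countable_univ (α := B))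
  choose ψ hψ using fun b => hdom b trivial
  exact ⟨ψ, Isometry.of_dist_eq fun a b => (hiso.1 _ (hψ a) _ (hψ b)).symm,
    fun a => hiso.eq_of_mem (hψ a) (hR ⟨a, rfl⟩)⟩

/-- The Urysohn space has the extension property as a structure without relations. -/
theorem IsUrysohnSpace.hasExtension {U : Type u} [MetricSpace U] (hU : IsUrysohnSpace U)
    {n : Fin 0 → ℕ} (f : ∀ i, (Fin (n i) → U) → ℝ) : HasExtension f := by
  intro X _ g _ R hR hiso x
  have := ((hR.image Prod.fst).insert x).to_subtype
  let Z := ↥(insert x (Prod.fst '' R))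
  -- The Urysohn property concerns metric spaces, so points of the pseudometric space at distance
  -- zero are identified.
  have : Finite (SeparationQuotient Z) := Quotient.finite _
  let π : Z → SeparationQuotient Z := SeparationQuotient.mk
  let c : R → Z := fun p => ⟨p.1.1, .inr ⟨p.1, p.2, rfl⟩⟩
  have hrange : ∀ a : Set.range (fun p => π (c p)), ∃ p, π (c p) = a := fun a => a.2
  choose r hr using hrange
  have hd : ∀ p q : R, dist (π (c p)) (π (c q)) = dist p.1.2 q.1.2 := fun p q =>
    hiso.1 _ p.2 _ q.2
  obtain ⟨ψ, hψ, hψr⟩ := hU.extension (SeparationQuotient Z) (Set.range fun p => π (c p))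
    (fun a => (r a).1.2) (Isometry.of_dist_eq fun a b => by
      rw [← hd, hr a, hr b, Subtype.dist_eq])
  have hψR : ∀ p : R, ψ (π (c p)) = p.1.2 := fun p => by
    rw [hψr ⟨_, p, rfl⟩]
    refine eq_of_dist_eq_zero ?_
    rw [← hd]
    exact dist_eq_zero.2 (hr ⟨_, p, rfl⟩)
  let x' : Z := ⟨x, .inl rfl⟩
  refine ⟨ψ (π x'), ?_, fun i => i.elim0⟩
  have hall : ∀ p ∈ insert (x, ψ (π x')) R, ∃ z : Z, p.1 = z ∧ p.2 = ψ (π z) := by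
    rintro p (rfl | hp)
    · exact ⟨x', rfl, rfl⟩
    · exact ⟨c ⟨p, hp⟩, rfl, (hψR ⟨p, hp⟩).symm⟩
  intro p hp q hq
  obtain ⟨a, ha1, ha2⟩ := hall p hp
  obtain ⟨b, hb1, hb2⟩ := hall q hq
  rw [ha1, hb1, ha2, hb2, hψ.dist_eq]
  rfl

theorem HasExtension.comp_isometryEquiv {U V : Type u} [PseudoMetricSpace U]
    [PseudoMetricSpace V] {g : ∀ i, (Fin (n i) → V) → ℝ} (h : HasExtension g) (Φ : U ≃ᵢ V) :
    HasExtension fun i (x : Fin (n i) → U) => g i fun j => Φ (x j) := by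
  intro X _ f hf R hR hiso x
  obtain ⟨y, hy⟩ := h X f hf (Prod.map id Φ '' R) (hR.image _) (by
    constructor
    · rintro _ ⟨p, hp, rfl⟩ _ ⟨q, hq, rfl⟩
      simpa [Φ.isometry.dist_eq] using hiso.1 p hp q hq
    · intro i s hs
      choose t ht hts using hs
      simpa [← hts] using hiso.2 i t ht) x
  have hmem : ∀ p ∈ insert (x, Φ.symm y) R, (p.1, Φ p.2) ∈ insert (x, y) (Prod.map id Φ '' R) := by
    rintro p (rfl | hp)
    · exact .inl (by simp)
    · exact .inr ⟨p, hp, rfl⟩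
  refine ⟨Φ.symm y, fun p hp q hq => ?_, fun i s hs => ?_⟩
  · rw [← Φ.isometry.dist_eq]
    exact hy.1 _ (hmem p hp) _ (hmem q hq)
  · exact hy.2 i (fun j => ((s j).1, Φ (s j).2)) fun j => hmem _ (hs j)

/-- The Urysohn space carries functions that make it a structure with the extension property. -/
theorem IsUrysohnSpace.exists_hasExtension {U : Type u} [MetricSpace U] (hU : IsUrysohnSpace U)
    (hn : ∀ i, 0 < n i) :
    ∃ f : ∀ i, (Fin (n i) → U) → ℝ, IsLip f ∧ HasExtension f := by
  have := hU.complete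
  have := hU.separable
  obtain ⟨V, _, g, _, _, hg, hge⟩ := _root_.exists_hasExtension.{u} n hn
  -- With all functions forgotten, `U` and `V` both have the extension property, hence are
  -- isometric; the functions of `V` are transported to `U`.
  let e : Fin 0 → ℕ := Fin.elim0
  have hUe := hU.hasExtension (n := e) fun i => i.elim0
  have hVe := (hge.isUrysohnSpace hg).hasExtension (n := e) fun i => i.elim0
  obtain ⟨Φ, -⟩ := HasExtension.exists_isometryEquiv (fun i => i.elim0) (fun i => i.elim0) hUe hVe
    Set.finite_empty (isPartialIso_empty fun i => i.elim0)
  exact ⟨fun i x => g i fun j => Φ (x j), fun i => ⟨fun x => (hg i).1 _, fun x y => by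
    simpa only [Φ.isometry.dist_eq] using (hg i).2 (fun j => Φ (x j)) (fun j => Φ (y j))⟩,
    hge.comp_isometryEquiv Φ⟩

end Main

theorem theorem2p1 {m : ℕ} (n : Fin m → ℕ) (hpos : ∀ i, 0 < n i) (hmono : Monotone n) :
    (∃ (U : Type u) (_ : MetricSpace U), IsUrysohnSpace U) ∧
    ∀ (U : Type u) [MetricSpace U], IsUrysohnSpace U →
      ∃ F : ∀ i, Set (Fin (n i) → U),
        (∀ i, IsClosed (F i)) ∧ IsUniversalStructure n F ∧ IsUltrahomogeneousStructure n F ∧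
        ∀ (V : Type u) [MetricSpace V] [CompleteSpace V] [TopologicalSpace.SeparableSpace V]
          (G : ∀ i, Set (Fin (n i) → V)),
          (∀ i, IsClosed (G i)) → IsUniversalStructure n G → IsUltrahomogeneousStructure n G →
          ∃ Φ : U ≃ᵢ V, ∀ i, ∀ x : Fin (n i) → U, (fun j => Φ (x j)) ∈ G i ↔ x ∈ F i := by
  refine ⟨?_, fun U _ hU => ?_⟩
  · obtain ⟨U, _, f, _, _, hf, hfe⟩ := exists_hasExtension.{u} n hpos
    exact ⟨U, _, hfe.isUrysohnSpace hf⟩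
  · have := hU.complete
    have := hU.separable
    obtain ⟨f, hf, hfe⟩ := hU.exists_hasExtension hpos
    refine ⟨fun i => {x | f i x = 0},
      fun i => isClosed_eq (hf.continuous i) continuous_const,
      hfe.isUniversalStructure hf hpos, hfe.isUltrahomogeneousStructure hf hpos, ?_⟩
    intro V _ _ _ G hG hGu hGh
    -- Uniqueness: both structures have the extension property, so back-and-forth from the empty
    -- partial isomorphism matches the functions and therefore their zero sets.
    obtain ⟨-, hGe⟩ := hfe.of_universal_of_ultrahomogeneous hf hpos hGu hGh
    obtain ⟨Φ, hΦ, -⟩ := HasExtension.exists_isometryEquiv hf (isLip_relValue G) hfe hGe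
      Set.finite_empty (isPartialIso_empty hpos)
    refine ⟨Φ, fun i x => ?_⟩
    rw [← relValue_eq_zero_iff (hG i), hΦ, Set.mem_ofPred_eq]
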